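/- Let $N\ge 1$ and $\lambda\in[0,1]$. On $(\mathbb C^2)^{\otimes N}$ with basis $|\mathbf n\rangle$, $\mathbf n\in\{0,1\}^N$, $|\mathbf n|=\sum_l n_l$, let $C[\lambda]$ be the coherence matrix of the $N$-qubit spin-boson model, with entries $\lambda^{(|\mathbf n|-|\mathbf m|)^2}$ (and $0^0=1$). An observable is a finite family of positive semidefinite matrices with sum $\mathbb 1$; two observables $\mathsf M,\mathsf F$ are jointly measurable if there is an observable $(\mathsf G(i,j))_{i,j}$ with $\sum_j\mathsf G(i,j)=\mathsf M(i)$ and $\sum_i\mathsf G(i,j)=\mathsf F(j)$ for all $i,j$. Let $\mathcal C_{C[\lambda]}$ be the set of observables $\mathsf P$, with all effects $\mathsf P(j)$ diagonal, such that $\mathsf P$ is jointly measurable with $(C[\lambda]*\mathsf Q(i))_i$ (entrywise product) for every observable $\mathsf Q$. For $j=0,\dots,N$ let $\mathsf P^C(j)$ be the projector onto $\mathrm{span}\{|\mathbf n\rangle : |\mathbf n|=j\}$ (the spectral resolution of the system Hamiltonian $\omega_0S_z$), and for $\alpha\in[0,1]$ put $\mathsf P^C_\alpha(j)=\alpha\,\mathsf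 P^C(j)+(1-\alpha)\,2^{-N}\mathrm{tr}[\mathsf P^C(j)]\,\mathbb 1$. Define $$\alpha_N(\lambda)=\max\{\alpha\in[0,1] : \mathsf P^C_\alpha\in\mathcal C_{C[\lambda]}\}.$$ With $c_N(k)=\binom Nk 2^{-N}$, let $$u_k(\alpha)=\sqrt{c_N(k)(1-\alpha)\bigl(\alpha+c_N(k)(1-\alpha)\bigr)}-c_N(k)(1-\alpha),\qquad \beta_{kk'}(\alpha)=1-\alpha+u_k(\alpha)+u_{k'}(\alpha),$$ let $\vartheta_3(x,\lambda)=1+2\sum_{k\ge1}\lambda^{k^2}\cos(2kx)$ for $0\le\lambda<1$, and let $\vartheta_3(\tfrac\pi2,1)=\lim_{\lambda\uparrow1}\vartheta_3(\tfrac\pi2,\lambda)$. Then the maximum defining $\alpha_N(\lambda)$ and the limit defining $\vartheta_3(\tfrac\pi2,1)$ exist, $\vartheta_3(\tfrac\pi2,\lambda)\in[0,1]$, the functions $\beta_{01}$ and $\beta_{00}$ are strictly decreasing bijections of $[0,1]$ onto $[0,1]$, and with $$U_N(\lambda)=[\beta_{01}]^{-1}(\lambda),\qquad L_N(\lambda)=[\beta_{00}]^{-1}\bigl(1-\vartheta_3(\tfrac\pi2,\lambda)\bigr)$$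 one has $$\vartheta_3(\tfrac\pi2,\lambda)\le L_N(\lambda)\le\alpha_N(\lambda)\le U_N(\lambda)\qquad\text{for all }N=1,2,\dots\text{ and }\lambda\in[0,1].$$ The lower bound $\vartheta_3(\tfrac\pi2,\lambda)$ does not depend on $N$. -/

import Mathlib

open scoped Matrix ComplexOrder

noncomputable section

namespace SpinBoson

/-- A finite-outcome observable (POVM): positive semidefinite effects summing to the identity. -/
def IsObservable {ι Ω : Type} [Fintype ι] [DecidableEq ι] [Fintype Ω]
    (M : Ω → Matrix ι ι ℂ) : Prop :=
  (∀ i, (M i).PosSemidef) ∧ ∑ i, M i = 1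

/-- An observable is incoherent if all its effects are diagonal in the incoherent basis. -/
def IsIncoherent {ι Ω : Type} (P : Ω → Matrix ι ι ℂ) : Prop :=
  ∀ j, (P j).IsDiag

/-- `M` and `F` are jointly measurable: they are the two marginals of a joint observable. -/
def JointlyMeasurable {ι Ω₁ Ω₂ : Type} [Fintype ι] [DecidableEq ι] [Fintype Ω₁] [Fintype Ω₂]
    (M : Ω₁ → Matrix ι ι ℂ) (F : Ω₂ → Matrix ι ι ℂ) : Prop :=
  ∃ G : Ω₁ × Ω₂ → Matrix ι ι ℂ, IsObservable G ∧
    (∀ i, ∑ j, G (i, j) = M i) ∧ (∀ j, ∑ i, G (i, j) = F j)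

/-- For a coherence matrix `C`, the set of incoherent observables (with outcome set `Ω`) that are
jointly measurable with the entrywise product `C ⊙ Q` for every finite-outcome observable `Q`. -/
def compatibleSet {ι : Type} [Fintype ι] [DecidableEq ι] (C : Matrix ι ι ℂ)
    (Ω : Type) [Fintype Ω] : Set (Ω → Matrix ι ι ℂ) :=
  {P | IsObservable P ∧ IsIncoherent P ∧
    ∀ (Ω' : Type) [Fintype Ω'] (Q : Ω' → Matrix ι ι ℂ), IsObservable Q →
      JointlyMeasurable (fun i => C ⊙ Q i) P}

/-- Labels `𝐧 = (n₁, …, n_N)`, `n_l ∈ {0, 1}`, of the `σ_z` basis of `N` qubits. -/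
abbrev QubitLabel (N : ℕ) : Type := Fin N → Fin 2

/-- `|𝐧| = ∑ n_l`. -/
def weight {N : ℕ} (n : QubitLabel N) : ℕ := ∑ l, (n l : ℕ)

/-- The spin-boson coherence matrix `C[t]`, with entries `t ^ ((|𝐧| - |𝐦|)²)`. -/
def coherenceMatrix (N : ℕ) (t : ℝ) : Matrix (QubitLabel N) (QubitLabel N) ℂ :=
  Matrix.of fun n m => ((t ^ (((weight n : ℤ) - (weight m : ℤ)).natAbs ^ 2) : ℝ) : ℂ)

/-- The spectral resolution of the system Hamiltonian `ω₀ S_z`: the `j`-th effect is the projector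
onto `span {|𝐧⟩ : |𝐧| = j}`, an eigenspace of the total spin `S_z`. -/
def spectralObservable (N : ℕ) (j : Fin (N + 1)) : Matrix (QubitLabel N) (QubitLabel N) ℂ :=
  Matrix.diagonal fun n => if weight n = (j : ℕ) then 1 else 0

/-- The depolarisation `2^(-N) tr[P(j)] 𝟙` of the spectral resolution. -/
def depolarisedObservable (N : ℕ) (j : Fin (N + 1)) :
    Matrix (QubitLabel N) (QubitLabel N) ℂ :=
  ((1 / 2 ^ N : ℂ) * (spectralObservable N j).trace) • 1

/-- The mixture `a P + (1 - a) P_dep` of the spectral resolution with its depolarisation. -/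
def mixedObservable (N : ℕ) (a : ℝ) (j : Fin (N + 1)) :
    Matrix (QubitLabel N) (QubitLabel N) ℂ :=
  (a : ℂ) • spectralObservable N j + ((1 - a : ℝ) : ℂ) • depolarisedObservable N j

/-- The mixing parameters `a ∈ [0, 1]` at which the mixture has no incompatibility due to the
coherence `C[t]`. -/
def compatibleMixing (N : ℕ) (t : ℝ) : Set ℝ :=
  {a | a ∈ Set.Icc (0 : ℝ) 1 ∧
    mixedObservable N a ∈ compatibleSet (coherenceMatrix N t) (Fin (N + 1))}

/-- The critical mixing parameter `α_N(t)`. -/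
def critical (N : ℕ) (t : ℝ) : ℝ := sSup (compatibleMixing N t)

/-- The binomial (coin toss) distribution `c_N(k)`. -/
def coin (N k : ℕ) : ℝ := (N.choose k : ℝ) / 2 ^ N

/-- `u_k(a) = √(c_N(k)(1-a)(a + c_N(k)(1-a))) - c_N(k)(1-a)`. -/
def u (N k : ℕ) (a : ℝ) : ℝ :=
  √(coin N k * (1 - a) * (a + coin N k * (1 - a))) - coin N k * (1 - a)

/-- `β_{k k'}(a) = 1 - a + u_k(a) + u_{k'}(a)`. -/
def beta (N k k' : ℕ) (a : ℝ) : ℝ := 1 - a + u N k a + u N k' a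

/-- The series `1 + 2 ∑_{k ≥ 1} q^(k²) cos (2 k x)`, which converges for `|q| < 1`. -/
def theta3Series (x q : ℝ) : ℝ :=
  1 + 2 * ∑' k : ℕ, q ^ ((k + 1) ^ 2) * Real.cos (2 * ((k : ℝ) + 1) * x)

/-- The Jacobi theta function `ϑ₃(x, q)` for `q ∈ [0, 1]`: the sum of its series for `q < 1`, and
the left limit of these sums at `q = 1`, where the series diverges. -/
def theta3 (x q : ℝ) : ℝ :=
  if q < 1 then theta3Series x q else Filter.limUnder (nhdsWithin 1 (Set.Iio 1)) (theta3Series x)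

/-- `U_N = β₀₁⁻¹`, the inverse of `β₀₁` as a function on `[0, 1]`. -/
def upperBound (N : ℕ) (t : ℝ) : ℝ :=
  Function.invFunOn (beta N 0 1) (Set.Icc 0 1) t

/-- `L_N(t) = β₀₀⁻¹(1 - ϑ₃(π/2, t))`, with the inverse of `β₀₀` as a function on `[0, 1]`. -/
def lowerBound (N : ℕ) (t : ℝ) : ℝ :=
  Function.invFunOn (beta N 0 0) (Set.Icc 0 1) (1 - theta3 (Real.pi / 2) t)

end SpinBoson

end

/-! ### Positive semidefinite matrices and joint measurability. -/

namespace SpinBoson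

open Matrix

/-! Lower bound: if `C = ∑ D j` with `D j` positive semidefinite and diagonal part `P j`, then by
Schur's product theorem the `D j ⊙ Q i` form a joint observable for any `Q`
(`mem_compatibleSet_of_decomposition`). For the mixture, `D j` is a two-block matrix (weight `j`
against the rest) times, entrywise, a Toeplitz matrix `h (|n| - |m|)` with `h 0 = 1`. Summed over
`j`, the blocks give `1` at equal weights and `β₀₀(a)` at different ones, so `h d` must be `t^(d²) /
β₀₀(a)` for `d ≠ 0`. Write `ϑ = ϑ₃(π/2, t)`. The symbol `∑ t^(d²) z^d` is smallest on the unit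
circle at `z = -1`, where it equals `ϑ`; thus `t^(d²) - ϑ δ` is positive definite (`theta3_spec`),
and `β₀₀(a) = 1 - ϑ` suffices.

The minimum at `-1` is read off the finite Jacobi triple product: each factor is `(1 + y z)(1 + y/z)
= (1 - y)² + y (2 + z + 1/z)`, its value at `-1` plus a term nonnegative on the circle. This is
carried out on coefficients, with positive definiteness in place of nonnegativity.

Upper bound: an observable separating `e_n + e_m` from `e_n - e_m` bounds `|C n m|` by the fidelity
of the outcome distributions of `P` at `n` and `m` (`norm_apply_le_of_mem_compatibleSet`). Weights
`0` and `1` give `t ≤ β₀₁(a)`. Monotonicity of the `β`s converts both results into bounds on `a`;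
compactness of the set of joint observables makes the supremum a maximum. -/

theorem isClosed_setOf_posSemidef {ι : Type*} [Fintype ι] :
    IsClosed {A : Matrix ι ι ℂ | A.PosSemidef} := by
  simp only [posSemidef_iff_dotProduct_mulVec, Set.ofPred_and, Set.ofPred_forall]
  refine IsClosed.inter ?_ (isClosed_iInter fun x => ?_)
  · exact isClosed_eq (continuous_id.matrix_conjTranspose) continuous_id
  · exact isClosed_le continuous_const
      (continuous_const.dotProduct (continuous_id.matrix_mulVec continuous_const))

theorem norm_apply_le_sqrt {ι : Type*} {A : Matrix ι ι ℂ} (hA : A.PosSemidef) (i j : ι) :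
    ‖A i j‖ ≤ √((A i i).re * (A j j).re) := by
  apply Real.le_sqrt_of_sq_le
  have h := (hA.submatrix ![i, j]).det_nonneg
  have hji : A j i = star (A i j) := (hA.isHermitian.apply j i).symm
  have hi := Complex.nonneg_iff.1 (hA.diag_nonneg (i := i))
  have hj := Complex.nonneg_iff.1 (hA.diag_nonneg (i := j))
  rw [det_fin_two] at h
  have h' := (Complex.nonneg_iff.1 h).1
  simp [hji, ← hi.2, ← hj.2] at h'
  rw [← Complex.normSq_eq_norm_sq, Complex.normSq_apply]
  linarith

/-- Completing the square: `z (f + (r/z) e)² + (p - r²/z) e²`. If `z = 0` then `r = 0`. -/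
theorem posSemidef_two_block {ι : Type*} [Fintype ι] {p z r : ℝ} (hp : 0 ≤ p) (hz : 0 ≤ z) (h : r ^ 2 ≤ p * z)
    (e f : ι → ℝ) :
    (Matrix.of fun i j => ((p * (e i * e j) + z * (f i * f j) +
      r * (e i * f j + f i * e j) : ℝ) : ℂ)).PosSemidef := by
  have key : ∀ v : ι → ℝ, ∀ c : ℝ, 0 ≤ c →
      (Matrix.of fun i j => ((c * (v i * v j) : ℝ) : ℂ)).PosSemidef := by
    intro v c hc
    have := (posSemidef_vecMulVec_self_star (fun i => (v i : ℂ))).smul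
      (Complex.zero_le_real.2 hc)
    convert this using 1
    ext i j
    simp [vecMulVec_apply]
  rcases hz.eq_or_lt with rfl | hz'
  · have hr : r = 0 := by nlinarith [sq_nonneg r]
    subst hr
    simpa using key e p hp
  · have h2 := (key (fun i => f i + r / z * e i) z hz).add
      (key e (p - r ^ 2 / z) (by rw [sub_nonneg, div_le_iff₀ hz']; exact h))
    convert h2 using 1
    ext i j
    simp only [of_apply, Matrix.add_apply, ← Complex.ofReal_add]
    congr 1
    field_simp
    ring

section Compatibility

variable {ι : Type} [Fintype ι] [DecidableEq ι]

theorem mem_compatibleSet_of_decomposition {C : Matrix ι ι ℂ} {Ω : Type} [Fintype Ω]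
    {P : Ω → Matrix ι ι ℂ} (hP : IsObservable P) (D : Ω → Matrix ι ι ℂ)
    (hD : ∀ j, (D j).PosSemidef) (hsum : ∑ j, D j = C) (hdiag : ∀ j, D j ⊙ 1 = P j) :
    P ∈ compatibleSet C Ω := by
  refine ⟨hP, fun j => ?_, fun Ω' _ Q hQ => ⟨fun p => D p.2 ⊙ Q p.1, ⟨fun p => ?_, ?_⟩, ?_, ?_⟩⟩
  · intro a b hab
    rw [← hdiag j]
    simp [hab]
  · exact (hD _).hadamard (hQ.1 _)
  · rw [Fintype.sum_prod_type_right, ← hP.2]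
    refine Finset.sum_congr rfl fun j _ => ?_
    rw [← hdiag j, ← hQ.2]
    ext a b
    simp [Matrix.sum_apply, Finset.mul_sum]
  · intro i
    ext a b
    simp [← hsum, Matrix.sum_apply, Finset.sum_mul]
  · intro j
    rw [← hdiag j, ← hQ.2]
    ext a b
    simp [Matrix.sum_apply, Finset.mul_sum]

theorem IsObservable.diag_le_one {Ω : Type} [Fintype Ω] {G : Ω → Matrix ι ι ℂ}
    (hG : IsObservable G) (p : Ω) (i : ι) : (G p i i).re ≤ 1 := by
  have h : ∑ q, (G q i i).re = 1 := by
    have := congrArg (fun A : Matrix ι ι ℂ => (A i i).re) hG.2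
    simpa [Matrix.sum_apply] using this
  rw [← h]
  exact Finset.single_le_sum (f := fun q => (G q i i).re)
    (fun q _ => (Complex.nonneg_iff.1 ((hG.1 q).diag_nonneg (i := i))).1) (Finset.mem_univ p)

theorem isCompact_setOf_isObservable (Ω : Type) [Fintype Ω] :
    IsCompact {G : Ω → Matrix ι ι ℂ | IsObservable G} := by
  have hK : IsCompact {G : Ω → Matrix ι ι ℂ | ∀ p, G p ∈ {A : Matrix ι ι ℂ |
      ∀ i, A i ∈ {v : ι → ℂ | ∀ j, v j ∈ Metric.closedBall (0 : ℂ) 1}}} :=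
    isCompact_pi_infinite fun _ => isCompact_pi_infinite fun _ => isCompact_pi_infinite fun _ =>
      isCompact_closedBall 0 1
  refine hK.of_isClosed_subset ?_ ?_
  · have h (p : Ω) : IsClosed {G : Ω → Matrix ι ι ℂ | (G p).PosSemidef} :=
      isClosed_setOf_posSemidef.preimage
        (f := fun G : Ω → Matrix ι ι ℂ => G p) (by fun_prop)
    have e : {G : Ω → Matrix ι ι ℂ | IsObservable G} =
        (⋂ p, {G : Ω → Matrix ι ι ℂ | (G p).PosSemidef}) ∩ {G | ∑ p, G p = 1} := by
      ext G
      simp [IsObservable]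
    rw [e]
    exact (isClosed_iInter h).inter (isClosed_eq (by fun_prop) continuous_const)
  · intro G hG p i j
    rw [mem_closedBall_zero_iff]
    refine (norm_apply_le_sqrt (hG.1 p) i j).trans ?_
    rw [Real.sqrt_le_one]
    exact mul_le_one₀ (hG.diag_le_one p i)
      (Complex.nonneg_iff.1 ((hG.1 p).diag_nonneg (i := j))).1 (hG.diag_le_one p j)

/-- The admissible `F` are the image of a compact set of joint observables under the continuous
marginal map. -/
theorem isClosed_setOf_jointlyMeasurable {Ω₁ Ω₂ : Type} [Fintype Ω₁] [Fintype Ω₂]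
    (M : Ω₁ → Matrix ι ι ℂ) :
    IsClosed {F : Ω₂ → Matrix ι ι ℂ | JointlyMeasurable M F} := by
  have hK : IsCompact ({G : Ω₁ × Ω₂ → Matrix ι ι ℂ | IsObservable G} ∩
      {G | ∀ i, ∑ j, G (i, j) = M i}) := by
    refine (isCompact_setOf_isObservable _).inter_right ?_
    simp only [Set.ofPred_forall]
    exact isClosed_iInter fun i => isClosed_eq (by fun_prop) continuous_const
  have hc : Continuous fun (G : Ω₁ × Ω₂ → Matrix ι ι ℂ) (j : Ω₂) => ∑ i, G (i, j) := by fun_prop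
  convert (hK.image hc).isClosed using 1
  ext F
  constructor
  · rintro ⟨G, h1, h2, h3⟩
    exact ⟨G, ⟨h1, h2⟩, funext h3⟩
  · rintro ⟨G, ⟨h1, h2⟩, h3⟩
    exact ⟨G, h1, h2, congrFun h3⟩

end Compatibility

/-- Coherence between two basis vectors is bounded by the fidelity of the outcome distributions of
any observable without incompatibility due to that coherence. -/
theorem norm_apply_le_of_mem_compatibleSet {ι : Type} [Fintype ι] [DecidableEq ι]
    {C : Matrix ι ι ℂ} {Ω : Type} [Fintype Ω] {P : Ω → Matrix ι ι ℂ}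
    (hP : P ∈ compatibleSet C Ω) {n m : ι} (hnm : n ≠ m) :
    ‖C n m‖ ≤ ∑ j, √((P j n n).re * (P j m m).re) := by
  obtain ⟨-, -, h⟩ := hP
  -- Effect `0` has `(n, m)` entry `1/2` and effect `1` has `-1/2`, so the difference of the two
  -- smeared effects recovers `C n m`. The diagonal `d` completes the sum to the identity.
  set v : ι → ℂ := fun i => if i = n ∨ i = m then 1 else 0 with hv
  set d : ι → ℂ := fun i => if i = n ∨ i = m then 0 else 1 with hd
  set w : ι → ℂ := fun i => if i = n then 1 else if i = m then -1 else 0 with hw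
  set Q : Fin 2 → Matrix ι ι ℂ := ![(1 / 2 : ℂ) • vecMulVec v (star v),
    (1 / 2 : ℂ) • vecMulVec w (star w) + diagonal d] with hQ
  have half : (0 : ℂ) ≤ 1 / 2 := by positivity
  have hobs : IsObservable Q := by
    constructor
    · rw [Fin.forall_fin_two]
      refine ⟨(posSemidef_vecMulVec_self_star v).smul half,
        ((posSemidef_vecMulVec_self_star w).smul half).add (PosSemidef.diagonal fun i => ?_)⟩
      simp only [hd, Pi.zero_apply]
      split_ifs <;> simp
    · ext i j
      simp only [hQ, Fin.sum_univ_two, cons_val_zero, cons_val_one, Matrix.add_apply, Matrix.smul_apply,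
        vecMulVec_apply, Pi.star_apply, diagonal_apply, one_apply, hv, hd, hw, smul_eq_mul]
      by_cases h1 : i = n <;> by_cases h2 : i = m <;> by_cases h3 : j = n <;>
        by_cases h4 : j = m <;> by_cases h5 : i = j <;> simp_all <;> norm_num
  obtain ⟨G, hG, hG1, hG2⟩ := h (Fin 2) Q hobs
  have h0 := congrFun (congrFun (hG1 0) n) m
  have h1 := congrFun (congrFun (hG1 1) n) m
  simp only [hQ, Matrix.sum_apply, hadamard_apply, cons_val_zero, cons_val_one, Matrix.add_apply,
    Matrix.smul_apply, vecMulVec_apply, Pi.star_apply, diagonal_apply, hv, hw, smul_eq_mul] at h0 h1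
  simp [hnm, hnm.symm] at h0 h1
  have hC : C n m = ∑ j, (G (0, j) n m - G (1, j) n m) := by
    rw [Finset.sum_sub_distrib, h0, h1]
    ring
  rw [hC]
  refine (norm_sum_le _ _).trans (Finset.sum_le_sum fun j _ => ?_)
  refine (norm_sub_le _ _).trans ((add_le_add (norm_apply_le_sqrt (hG.1 _) n m)
    (norm_apply_le_sqrt (hG.1 _) n m)).trans ?_)
  have hpos : ∀ (k : Fin 2) (i : ι), 0 ≤ (G (k, j) i i).re := fun k i =>
    (Complex.nonneg_iff.1 ((hG.1 (k, j)).diag_nonneg (i := i))).1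
  have hPj : ∀ i, (P j i i).re = (G (0, j) i i).re + (G (1, j) i i).re := by
    intro i
    have := congrArg (fun A : Matrix ι ι ℂ => (A i i).re) (hG2 j)
    simpa [Fin.sum_univ_two] using this.symm
  rw [hPj, hPj]
  -- Cauchy–Schwarz in `ℝ²`: `√(x₀y₀) + √(x₁y₁) ≤ √((x₀ + x₁)(y₀ + y₁))`.
  apply Real.le_sqrt_of_sq_le
  have e0 := Real.sqrt_mul (hpos 0 n) (G (0, j) m m).re
  have e1 := Real.sqrt_mul (hpos 1 n) (G (1, j) m m).re
  rw [e0, e1]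
  nlinarith [Real.sq_sqrt (hpos 0 n), Real.sq_sqrt (hpos 1 n), Real.sq_sqrt (hpos 0 m),
    Real.sq_sqrt (hpos 1 m), sq_nonneg (√(G (0, j) n n).re * √(G (1, j) m m).re -
      √(G (1, j) n n).re * √(G (0, j) m m).re)]

end SpinBoson

/-! ### Positive definite sequences on the integers. -/

namespace SpinBoson

open Matrix Filter Topology

/-- Positive definiteness of a real function on `ℤ`: all matrices `g (w i - w j)` are positive
semidefinite. -/
def IsPosDefSeq (g : ℤ → ℝ) : Prop :=
  ∀ (ι : Type) [Fintype ι] (w : ι → ℤ),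
    (Matrix.of fun i j => ((g (w i - w j) : ℝ) : ℂ)).PosSemidef

namespace IsPosDefSeq

theorem add {g h : ℤ → ℝ} (hg : IsPosDefSeq g) (hh : IsPosDefSeq h) :
    IsPosDefSeq fun d => g d + h d := by
  intro ι _ w
  convert (hg ι w).add (hh ι w) using 1
  ext i j
  simp

theorem const_mul {g : ℤ → ℝ} (hg : IsPosDefSeq g) {c : ℝ} (hc : 0 ≤ c) :
    IsPosDefSeq fun d => c * g d := by
  intro ι _ w
  convert (hg ι w).smul (Complex.zero_le_real.2 hc) using 1
  ext i j
  simp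

theorem one : IsPosDefSeq fun _ => 1 := by
  intro ι _ w
  convert posSemidef_vecMulVec_self_star (fun _ : ι => (1 : ℂ)) using 1
  ext i j
  simp [vecMulVec_apply]

theorem delta : IsPosDefSeq fun d => if d = 0 then 1 else 0 := by
  intro ι _ w
  classical
  convert posSemidef_sum (R := ℂ) (Finset.univ.image w) (x := fun k =>
    vecMulVec (fun i => if w i = k then (1 : ℂ) else 0) (star fun i => if w i = k then (1 : ℂ) else 0))
    (fun k _ => posSemidef_vecMulVec_self_star _) using 1
  ext i j
  simp only [Matrix.sum_apply, vecMulVec_apply, Pi.star_apply, of_apply, sub_eq_zero]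
  rw [Finset.sum_eq_single (w i)]
  · simp only [eq_comm (a := w j)]
    split_ifs <;> simp
  · intro k _ hk
    simp [hk.symm]
  · simp

/-- Multiplication of the symbol by `|1 + z|² = 2 + z + 1/z`: double the points to `w i` and `w i +
1`, then add the two copies by a congruence. -/
theorem shift_sum {g : ℤ → ℝ} (hg : IsPosDefSeq g) :
    IsPosDefSeq fun d => 2 * g d + (g (d - 1) + g (d + 1)) := by
  intro ι _ w
  classical
  have h := (hg (ι × Fin 2) fun p => w p.1 + (p.2 : ℕ)).conjTranspose_mul_mul_same
    (Matrix.of fun (p : ι × Fin 2) i => if p.1 = i then (1 : ℂ) else 0)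
  convert h using 1
  ext i j
  simp only [mul_apply, conjTranspose_apply, of_apply, Fintype.sum_prod_type, Fin.sum_univ_two,
    apply_ite star, star_one, star_zero, ite_mul, mul_ite, mul_one, one_mul, mul_zero, zero_mul,
    Finset.sum_add_distrib, Finset.sum_ite_eq', Finset.mem_univ, if_true, ← Complex.ofReal_add]
  congr 1
  simp only [Fin.val_zero, Fin.val_one, Nat.cast_zero, Nat.cast_one, add_zero]
  rw [show w i + 1 - (w j + 1) = w i - w j by ring, show w i + 1 - w j = w i - w j + 1 by ring,
    show w i - (w j + 1) = w i - w j - 1 by ring]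
  ring

theorem of_tendsto {g : ℕ → ℤ → ℝ} {h : ℤ → ℝ} (hg : ∀ m, IsPosDefSeq (g m))
    (hlim : ∀ d, Tendsto (fun m => g m d) atTop (𝓝 (h d))) : IsPosDefSeq h := by
  intro ι _ w
  have ht : Tendsto (fun m => Matrix.of fun i j => ((g m (w i - w j) : ℝ) : ℂ)) atTop
      (𝓝 (Matrix.of fun i j => ((h (w i - w j) : ℝ) : ℂ))) :=
    tendsto_pi_nhds.2 fun i => tendsto_pi_nhds.2 fun j =>
      (Complex.continuous_ofReal.tendsto _).comp (hlim (w i - w j))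
  exact isClosed_setOf_posSemidef.mem_of_tendsto ht (Eventually.of_forall fun m => hg m ι w)

theorem zero_le {g : ℤ → ℝ} (hg : IsPosDefSeq g) : 0 ≤ g 0 := by
  have := (hg Unit fun _ => 0).diag_nonneg (i := ())
  simpa using this

theorem abs_le {g : ℤ → ℝ} (hg : IsPosDefSeq g) (d : ℤ) : |g d| ≤ g 0 := by
  have := norm_apply_le_sqrt (hg (Fin 2) ![d, 0]) 0 1
  simpa [Real.sqrt_mul_self hg.zero_le] using this

end IsPosDefSeq

end SpinBoson

/-! ### The theta function through the finite Jacobi triple product. -/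

namespace SpinBoson

open Filter Topology

/-- The finite `q`-Pochhammer product `(Q; Q)_n`. -/
noncomputable def qPoch (Q : ℝ) (n : ℕ) : ℝ := ∏ i ∈ Finset.range n, (1 - Q ^ (i + 1))

/-- The reciprocal of `(Q; Q)_k`, extended by zero to negative `k`. -/
noncomputable def qPochInv (Q : ℝ) (k : ℤ) : ℝ := if 0 ≤ k then (qPoch Q k.toNat)⁻¹ else 0

section Pochhammer

variable {Q : ℝ}

theorem qPoch_factor_pos (h0 : 0 < Q) (h1 : Q < 1) (i : ℕ) : 0 < 1 - Q ^ (i + 1) :=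
  sub_pos.2 (pow_lt_one₀ h0.le h1 i.succ_ne_zero)

theorem qPoch_pos (h0 : 0 < Q) (h1 : Q < 1) (n : ℕ) : 0 < qPoch Q n :=
  Finset.prod_pos fun i _ => qPoch_factor_pos h0 h1 i

theorem qPoch_succ (n : ℕ) : qPoch Q (n + 1) = qPoch Q n * (1 - Q ^ (n + 1)) :=
  Finset.prod_range_succ _ _

theorem qPoch_antitone (h0 : 0 < Q) (h1 : Q < 1) : Antitone (qPoch Q) := by
  refine antitone_nat_of_succ_le fun n => ?_
  rw [qPoch_succ]
  exact mul_le_of_le_one_right (qPoch_pos h0 h1 n).le (by linarith [pow_pos h0 (n + 1)])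

theorem qPoch_le_one (h0 : 0 < Q) (h1 : Q < 1) (n : ℕ) : qPoch Q n ≤ 1 := by
  simpa [qPoch] using qPoch_antitone h0 h1 (Nat.zero_le n)

theorem exists_tendsto_qPoch (h0 : 0 < Q) (h1 : Q < 1) :
    ∃ c, 0 < c ∧ (∀ n, c ≤ qPoch Q n) ∧ Tendsto (qPoch Q) atTop (𝓝 c) := by
  have hs : Summable fun i : ℕ => -Q ^ (i + 1) :=
    ((summable_nat_add_iff 1).2 (summable_geometric_of_lt_one h0.le h1)).neg
  have hlog := (Real.summable_log_one_add_of_summable hs).hasSum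
  have hp := Real.hasProd_of_hasSum_log (fun i => by
    simpa [sub_eq_add_neg] using qPoch_factor_pos h0 h1 i) hlog
  have ht := hp.tendsto_prod_nat
  simp only [← sub_eq_add_neg] at ht
  exact ⟨_, Real.exp_pos _, fun n => (qPoch_antitone h0 h1).le_of_tendsto ht n, ht⟩

/-- Extension by zero is what makes this recursion valid at every integer: at `k = 0` the factor `1
- Q ^ k` vanishes. -/
theorem qPochInv_sub_one (h0 : 0 < Q) (h1 : Q < 1) (k : ℤ) :
    qPochInv Q (k - 1) = (1 - Q ^ k) * qPochInv Q k := by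
  rcases lt_trichotomy k 0 with hk | rfl | hk
  · simp [qPochInv, not_le.2 hk, show ¬ (1 : ℤ) ≤ k by omega]
  · simp [qPochInv]
  · obtain ⟨n, rfl⟩ : ∃ n : ℕ, k = n + 1 := ⟨(k - 1).toNat, by omega⟩
    have h := (qPoch_factor_pos h0 h1 n).ne'
    have h' := (qPoch_pos h0 h1 n).ne'
    have e : ((n : ℤ) + 1).toNat = n + 1 := by omega
    have e' : Q ^ ((n : ℤ) + 1) = Q ^ (n + 1) := by exact_mod_cast zpow_natCast Q (n + 1)
    simp only [qPochInv, add_sub_cancel_right, Int.natCast_nonneg, if_true, Int.toNat_natCast, e,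
      e', qPoch_succ, show (0 : ℤ) ≤ n + 1 by omega]
    field_simp

theorem qPochInv_nonneg (h0 : 0 < Q) (h1 : Q < 1) (k : ℤ) : 0 ≤ qPochInv Q k := by
  unfold qPochInv
  split_ifs
  · exact (inv_pos.2 (qPoch_pos h0 h1 _)).le
  · exact le_rfl

theorem qPochInv_le {c : ℝ} (hc : 0 < c) (h : ∀ n, c ≤ qPoch Q n) (k : ℤ) :
    qPochInv Q k ≤ c⁻¹ := by
  unfold qPochInv
  split_ifs
  · exact inv_anti₀ hc (h _)
  · exact (inv_pos.2 hc).le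

theorem tendsto_qPochInv {c : ℝ} (hc : 0 < c) (h : Tendsto (qPoch Q) atTop (𝓝 c)) (d : ℤ) :
    Tendsto (fun m : ℕ => qPochInv Q (m + d)) atTop (𝓝 c⁻¹) := by
  have ht : Tendsto (fun m : ℕ => ((m : ℤ) + d).toNat) atTop atTop := by
    refine tendsto_atTop.2 fun b => ?_
    filter_upwards [eventually_ge_atTop (b + d.natAbs)] with m hm
    omega
  refine ((h.comp ht).inv₀ hc.ne').congr' ?_
  filter_upwards [eventually_ge_atTop d.natAbs] with m hm
  simp [qPochInv, show 0 ≤ (m : ℤ) + d by omega]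

end Pochhammer

/-- The coefficient of `z ^ d` in `∏ n < m, (1 + q ^ (2 n + 1) z) (1 + q ^ (2 n + 1) z⁻¹)`. -/
noncomputable def thetaCoeff (q : ℝ) (m : ℕ) (d : ℤ) : ℝ :=
  q ^ (d ^ 2) * qPoch (q ^ 2) (2 * m) * qPochInv (q ^ 2) (m - d) * qPochInv (q ^ 2) (m + d)

/-- The value of `∏ n < m, (1 + q ^ (2 n + 1) z) (1 + q ^ (2 n + 1) z⁻¹)` at `z = -1`. -/
noncomputable def thetaProd (q : ℝ) (m : ℕ) : ℝ :=
  ∏ i ∈ Finset.range m, (1 - q ^ (2 * i + 1)) ^ 2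

section Theta

variable {q : ℝ}

theorem thetaCoeff_zero (q : ℝ) (d : ℤ) :
    thetaCoeff q 0 d = if d = 0 then 1 else 0 := by
  rcases lt_trichotomy d 0 with hd | rfl | hd
  · simp [thetaCoeff, qPochInv, hd.ne, hd.not_ge]
  · simp [thetaCoeff, qPochInv, qPoch]
  · simp [thetaCoeff, qPochInv, hd.ne', hd.not_ge]

/-- Coefficient form of multiplication by `1 + y² + y (z + 1/z)`, `y = q ^ (2 m + 1)`. All
reciprocals are reduced to those at `m + 1 ± d` and all powers to `q ^ m`, `q ^ d`, `q ^ (d ^ 2)`,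
leaving a rational identity. -/
theorem thetaCoeff_succ (h0 : 0 < q) (h1 : q < 1) (m : ℕ) (d : ℤ) :
    thetaCoeff q (m + 1) d = (1 + (q ^ (2 * m + 1)) ^ 2) * thetaCoeff q m d +
      q ^ (2 * m + 1) * (thetaCoeff q m (d - 1) + thetaCoeff q m (d + 1)) := by
  have hQ0 : 0 < q ^ 2 := by positivity
  have hQ1 : q ^ 2 < 1 := pow_lt_one₀ h0.le h1 two_ne_zero
  have hq := h0.ne'
  have hx : q ^ d ≠ 0 := zpow_ne_zero _ hq
  have s1 := qPochInv_sub_one hQ0 hQ1 (m + 1 - d)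
  have s2 := qPochInv_sub_one hQ0 hQ1 (m + 1 - d - 1)
  have s3 := qPochInv_sub_one hQ0 hQ1 (m + 1 + d)
  have s4 := qPochInv_sub_one hQ0 hQ1 (m + 1 + d - 1)
  rw [s1] at s2
  rw [s3] at s4
  have z1 : (q ^ 2) ^ ((m : ℤ) + 1 - d) = (q ^ m) ^ 2 * q ^ 2 / (q ^ d) ^ 2 := by
    rw [zpow_sub₀ hQ0.ne', zpow_add₀ hQ0.ne', zpow_one, zpow_natCast, ← pow_mul, ← pow_mul,
      mul_comm 2 m, ← zpow_natCast q 2, ← zpow_mul, mul_comm ((2 : ℕ) : ℤ) d, zpow_mul,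
      zpow_natCast, zpow_natCast]
  have z3 : (q ^ 2) ^ ((m : ℤ) + 1 + d) = (q ^ m) ^ 2 * q ^ 2 * (q ^ d) ^ 2 := by
    rw [zpow_add₀ hQ0.ne', zpow_add₀ hQ0.ne', zpow_one, zpow_natCast, ← pow_mul, ← pow_mul,
      mul_comm 2 m, ← zpow_natCast q 2, ← zpow_mul, mul_comm ((2 : ℕ) : ℤ) d, zpow_mul,
      zpow_natCast, zpow_natCast]
  have z2 : (q ^ 2) ^ ((m : ℤ) + 1 - d - 1) = (q ^ m) ^ 2 / (q ^ d) ^ 2 := by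
    rw [zpow_sub_one₀ hQ0.ne', z1]
    field_simp
  have z4 : (q ^ 2) ^ ((m : ℤ) + 1 + d - 1) = (q ^ m) ^ 2 * (q ^ d) ^ 2 := by
    rw [zpow_sub_one₀ hQ0.ne', z3]
    field_simp
  have x1 : q ^ ((d - 1) ^ 2) = q ^ (d ^ 2) * q / (q ^ d) ^ 2 := by
    rw [show (d - 1) ^ 2 = d ^ 2 + 1 - (d + d) by ring, zpow_sub₀ hq, zpow_add₀ hq, zpow_add₀ hq,
      zpow_one, sq (q ^ d)]
  have x2 : q ^ ((d + 1) ^ 2) = q ^ (d ^ 2) * q * (q ^ d) ^ 2 := by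
    rw [show (d + 1) ^ 2 = d ^ 2 + 1 + (d + d) by ring, zpow_add₀ hq, zpow_add₀ hq, zpow_add₀ hq,
      zpow_one, sq (q ^ d)]
  have p : qPoch (q ^ 2) (2 * (m + 1)) = qPoch (q ^ 2) (2 * m) *
      (1 - (q ^ m) ^ 4 * q ^ 2) * (1 - (q ^ m) ^ 4 * q ^ 4) := by
    rw [show 2 * (m + 1) = 2 * m + 1 + 1 by ring, qPoch_succ, qPoch_succ]
    ring
  have y : q ^ (2 * m + 1) = (q ^ m) ^ 2 * q := by ring
  simp only [thetaCoeff, Nat.cast_add, Nat.cast_one, p, x1, x2, y]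
  rw [show (m : ℤ) - (d - 1) = m + 1 - d by ring, show (m : ℤ) + (d + 1) = m + 1 + d by ring,
    show (m : ℤ) - d = m + 1 - d - 1 by ring, show (m : ℤ) + d = m + 1 + d - 1 by ring,
    show (m : ℤ) - (d + 1) = m + 1 - d - 1 - 1 by ring,
    show (m : ℤ) + (d - 1) = m + 1 + d - 1 - 1 by ring, s2, s4, s1, s3, z1, z2, z3, z4]
  field_simp
  ring

theorem thetaProd_nonneg (q : ℝ) (m : ℕ) : 0 ≤ thetaProd q m :=
  Finset.prod_nonneg fun _ _ => sq_nonneg _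

theorem thetaProd_succ (q : ℝ) (m : ℕ) :
    thetaProd q (m + 1) = thetaProd q m * (1 - q ^ (2 * m + 1)) ^ 2 :=
  Finset.prod_range_succ _ _

theorem thetaProd_succ_le (h0 : 0 < q) (h1 : q < 1) (m : ℕ) :
    thetaProd q (m + 1) ≤ (1 - q) ^ 2 := by
  induction m with
  | zero => simp [thetaProd]
  | succ m ih =>
    rw [thetaProd_succ]
    refine (mul_le_of_le_one_right (thetaProd_nonneg q _) ?_).trans ih
    have := pow_pos h0 (2 * (m + 1) + 1)
    have := pow_le_one₀ h0.le h1.le (n := 2 * (m + 1) + 1)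
    exact pow_le_one₀ (by linarith) (by linarith)

/-- Induction on the splitting `(1 - y)² + y (2 + z + 1/z)` of each factor. The first part
multiplies the product of values at `-1`; the second is a `shift_sum` of the full coefficients,
hence the joint induction. -/
theorem isPosDefSeq_thetaCoeff (h0 : 0 < q) (h1 : q < 1) (m : ℕ) :
    IsPosDefSeq (thetaCoeff q m) ∧
      IsPosDefSeq fun d => thetaCoeff q m d - thetaProd q m * (if d = 0 then 1 else 0) := by
  induction m with
  | zero =>
    have e : thetaCoeff q 0 = fun d => if d = 0 then 1 else 0 := funext (thetaCoeff_zero q)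
    refine ⟨e ▸ .delta, ?_⟩
    convert IsPosDefSeq.delta.const_mul le_rfl using 2 with d
    simp [e, thetaProd]
  | succ m ih =>
    have hq : 0 ≤ q ^ (2 * m + 1) := by positivity
    have hs := ih.1.shift_sum.const_mul hq
    constructor
    · convert (ih.1.const_mul (sq_nonneg (1 - q ^ (2 * m + 1)))).add hs using 2 with d
      rw [thetaCoeff_succ h0 h1]
      ring
    · convert (ih.2.const_mul (sq_nonneg (1 - q ^ (2 * m + 1)))).add hs using 2 with d
      rw [thetaCoeff_succ h0 h1, thetaProd_succ]
      ring

/-- Evaluation at `z = -1`: shifting `d` by one flips the sign, so the recursion multiplies the sum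
by `1 + y² - 2 y`. -/
theorem hasSum_thetaCoeff (h0 : 0 < q) (h1 : q < 1) (m : ℕ) :
    HasSum (fun d : ℤ => (-1) ^ d * thetaCoeff q m d) (thetaProd q m) := by
  induction m with
  | zero =>
    convert hasSum_ite_eq (0 : ℤ) (1 : ℝ) using 2 with d
    · rw [thetaCoeff_zero q]
      split_ifs with h <;> simp [h]
    · simp [thetaProd]
  | succ m ih =>
    have hm := ((Equiv.subRight (1 : ℤ)).hasSum_iff.2 ih)
    have hp := ((Equiv.addRight (1 : ℤ)).hasSum_iff.2 ih)
    have h := (ih.mul_left (1 + (q ^ (2 * m + 1)) ^ 2)).sub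
      ((hm.add hp).mul_left (q ^ (2 * m + 1)))
    have e : thetaProd q (m + 1) = (1 + (q ^ (2 * m + 1)) ^ 2) * thetaProd q m -
        q ^ (2 * m + 1) * (thetaProd q m + thetaProd q m) := by
      rw [thetaProd_succ]
      ring
    rw [e]
    refine h.congr_fun ?_
    · intro d
      simp only [Function.comp_apply, Equiv.subRight_apply, Equiv.coe_addRight,
        zpow_sub_one₀ (by norm_num : (-1 : ℝ) ≠ 0), zpow_add_one₀ (by norm_num : (-1 : ℝ) ≠ 0)]
      rw [thetaCoeff_succ h0 h1]
      norm_num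
      ring

theorem summable_pow_sq (h0 : 0 < q) (h1 : q < 1) : Summable fun d : ℤ => q ^ (d ^ 2) := by
  have h : Summable fun n : ℕ => q ^ (n ^ 2) := by
    refine Summable.of_nonneg_of_le (fun n => by positivity) (fun n => ?_)
      (summable_geometric_of_lt_one h0.le h1)
    exact pow_le_pow_of_le_one h0.le h1.le (Nat.le_self_pow two_ne_zero n)
  refine Summable.of_nat_of_neg ?_ ?_
  · exact_mod_cast h
  · simp only [neg_sq]
    exact_mod_cast h

theorem tsum_eq_theta3Series (h0 : 0 < q) (h1 : q < 1) :
    ∑' d : ℤ, (-1) ^ d * q ^ (d ^ 2) = theta3Series (Real.pi / 2) q := by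
  have hs : Summable fun d : ℤ => (-1 : ℝ) ^ d * q ^ (d ^ 2) := by
    refine Summable.of_norm_bounded (summable_pow_sq h0 h1) fun d => ?_
    simp [abs_of_pos h0]
  have he : Function.Even fun d : ℤ => (-1 : ℝ) ^ d * q ^ (d ^ 2) := by
    intro d
    simp only [neg_sq, zpow_neg, ← inv_zpow, inv_neg, inv_one]
  rw [tsum_int_eq_zero_add_two_mul_tsum_pnat he hs, tsum_pnat_eq_tsum_succ
    (f := fun n : ℕ => (-1 : ℝ) ^ (n : ℤ) * q ^ ((n : ℤ) ^ 2)), theta3Series]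
  simp only [zpow_zero, one_mul, ne_eq, OfNat.ofNat_ne_zero, not_false_eq_true, zero_pow]
  rw [nsmul_eq_mul, Nat.cast_ofNat]
  congr 3
  funext k
  rw [show 2 * ((k : ℝ) + 1) * (Real.pi / 2) = ((k + 1 : ℕ) : ℝ) * Real.pi by push_cast; ring,
    Real.cos_nat_mul_pi, zpow_natCast, mul_comm]
  congr 1

/-- Let `m → ∞`. With `c = (q²; q²)_∞`, the coefficients tend to `q ^ (d²) / c` and the value at
`-1` to `ϑ / c`. Since `c ≤ 1`, the bound `(1 - q)²` passes to `ϑ`; it forces `ϑ → 0` as `q → 1`. -/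
theorem theta3Series_spec (h0 : 0 < q) (h1 : q < 1) :
    0 ≤ theta3Series (Real.pi / 2) q ∧ theta3Series (Real.pi / 2) q ≤ (1 - q) ^ 2 ∧
      IsPosDefSeq fun d => q ^ (d.natAbs ^ 2) -
        theta3Series (Real.pi / 2) q * (if d = 0 then 1 else 0) := by
  have hQ0 : 0 < q ^ 2 := by positivity
  have hQ1 : q ^ 2 < 1 := pow_lt_one₀ h0.le h1 two_ne_zero
  obtain ⟨c, hc, hcle, hct⟩ := exists_tendsto_qPoch hQ0 hQ1
  have hc1 : c ≤ 1 := (hcle 0).trans (qPoch_le_one hQ0 hQ1 0)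
  have hlim : ∀ d : ℤ, Tendsto (fun m => thetaCoeff q m d) atTop (𝓝 (q ^ (d ^ 2) * c⁻¹)) := by
    intro d
    have h2 : Tendsto (fun m => qPoch (q ^ 2) (2 * m)) atTop (𝓝 c) :=
      hct.comp (tendsto_id.const_mul_atTop' two_pos)
    have h := ((h2.const_mul (q ^ (d ^ 2))).mul (tendsto_qPochInv hc hct (-d))).mul
      (tendsto_qPochInv hc hct d)
    convert h using 2
    · simp only [thetaCoeff, sub_eq_add_neg]
    · field_simp
  have hprod : Tendsto (thetaProd q) atTop (𝓝 (theta3Series (Real.pi / 2) q * c⁻¹)) := by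
    have h := tendsto_tsum_of_dominated_convergence (𝓕 := atTop)
      (f := fun m (d : ℤ) => (-1) ^ d * thetaCoeff q m d)
      (g := fun d : ℤ => (-1) ^ d * (q ^ (d ^ 2) * c⁻¹))
      -- The majorant is uniform in `m`: the Pochhammer numerator is at most `1` and each reciprocal
      -- at most `c⁻¹`.
      ((summable_pow_sq h0 h1).mul_right (c⁻¹ * c⁻¹))
      (fun d => (hlim d).const_mul _) (Eventually.of_forall fun m d => ?_)
    · simp only [(hasSum_thetaCoeff h0 h1 _).tsum_eq] at h
      rw [← tsum_eq_theta3Series h0 h1, ← tsum_mul_right]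
      simpa only [mul_assoc] using h
    · have n1 := qPochInv_nonneg hQ0 hQ1 (m - d)
      have n2 := qPochInv_nonneg hQ0 hQ1 (m + d)
      have n3 := (qPoch_pos hQ0 hQ1 (2 * m)).le
      have n4 : 0 < q ^ (d ^ 2) := zpow_pos h0 _
      rw [norm_mul, norm_zpow, norm_neg, norm_one, one_zpow, one_mul, Real.norm_of_nonneg
        (by unfold thetaCoeff; positivity), thetaCoeff, mul_assoc]
      gcongr
      · exact mul_le_of_le_one_right n4.le (qPoch_le_one hQ0 hQ1 _)
      · exact qPochInv_le hc hcle _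
      · exact qPochInv_le hc hcle _
  have hle : theta3Series (Real.pi / 2) q * c⁻¹ ≤ (1 - q) ^ 2 :=
    le_of_tendsto ((tendsto_add_atTop_iff_nat 1).2 hprod)
      (Eventually.of_forall fun m => thetaProd_succ_le h0 h1 m)
  have hpos : 0 ≤ theta3Series (Real.pi / 2) q := by
    have := ge_of_tendsto' hprod (thetaProd_nonneg q)
    exact nonneg_of_mul_nonneg_left this (inv_pos.2 hc)
  refine ⟨hpos, (le_mul_of_one_le_right hpos ((one_le_inv₀ hc).2 hc1)).trans hle, ?_⟩
  have hpd := (IsPosDefSeq.of_tendsto (fun m => (isPosDefSeq_thetaCoeff h0 h1 m).2)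
    (fun d => (hlim d).sub (hprod.mul_const _))).const_mul hc.le
  convert hpd using 2 with d
  have e : q ^ (d ^ 2) = q ^ (d.natAbs ^ 2) := by
    rw [← zpow_natCast]
    simp
  rw [e]
  field_simp

theorem tendsto_theta3Series_one :
    Tendsto (theta3Series (Real.pi / 2)) (𝓝[<] 1) (𝓝 0) := by
  have hmem : Set.Ioo (0 : ℝ) 1 ∈ 𝓝[<] (1 : ℝ) := Ioo_mem_nhdsLT one_pos
  have hsq : Tendsto (fun q : ℝ => (1 - q) ^ 2) (𝓝[<] 1) (𝓝 0) := by
    have : Continuous fun q : ℝ => (1 - q) ^ 2 := by fun_prop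
    simpa using (this.tendsto 1).mono_left nhdsWithin_le_nhds
  refine tendsto_of_tendsto_of_tendsto_of_le_of_le' tendsto_const_nhds hsq ?_ ?_
  · filter_upwards [hmem] with q hq using (theta3Series_spec hq.1 hq.2).1
  · filter_upwards [hmem] with q hq using (theta3Series_spec hq.1 hq.2).2.1

theorem theta3_one : theta3 (Real.pi / 2) 1 = 0 := by
  simpa [theta3] using tendsto_theta3Series_one.limUnder_eq

/-- `ϑ₃(π/2, t)` lies in `[0, 1]` and bounds the spectrum of the Toeplitz matrices `t ^ (k - l)²`
from below. -/
theorem theta3_spec {t : ℝ} (ht : t ∈ Set.Icc (0 : ℝ) 1) :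
    theta3 (Real.pi / 2) t ∈ Set.Icc (0 : ℝ) 1 ∧
      IsPosDefSeq fun d => t ^ (d.natAbs ^ 2) -
        theta3 (Real.pi / 2) t * (if d = 0 then 1 else 0) := by
  rcases ht.2.eq_or_lt with rfl | h1
  · rw [theta3_one]
    simpa using IsPosDefSeq.one
  rcases ht.1.eq_or_lt with rfl | h0
  · have e : theta3 (Real.pi / 2) 0 = 1 := by simp [theta3, theta3Series]
    rw [e]
    refine ⟨by simp, ?_⟩
    convert IsPosDefSeq.delta.const_mul le_rfl using 2 with d
    split_ifs with h <;> simp [h]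
  · have e : theta3 (Real.pi / 2) t = theta3Series (Real.pi / 2) t := by simp [theta3, h1]
    obtain ⟨ha, hb, hc⟩ := theta3Series_spec h0 h1
    rw [e]
    exact ⟨⟨ha, hb.trans (pow_le_one₀ (by linarith) (by linarith))⟩, hc⟩

end Theta

end SpinBoson

/-! ### The functions `u_k` and `β_{kk'}`. -/

namespace SpinBoson

section Beta

variable {N : ℕ} {a : ℝ}

theorem coin_nonneg (N k : ℕ) : 0 ≤ coin N k := by
  unfold coin
  positivity

theorem coin_zero_le {k : ℕ} (hk : k ≤ N) : coin N 0 ≤ coin N k := by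
  unfold coin
  gcongr
  rw [Nat.choose_zero_right]
  exact Nat.choose_pos hk

theorem sum_coin (N : ℕ) : ∑ j : Fin (N + 1), coin N j = 1 := by
  rw [Fin.sum_univ_eq_sum_range (fun k => coin N k)]
  simp only [coin, ← Finset.sum_div]
  rw [div_eq_one_iff_eq (by positivity)]
  exact_mod_cast Nat.sum_range_choose N

theorem u_nonneg (ha : a ∈ Set.Icc (0 : ℝ) 1) (k : ℕ) : 0 ≤ u N k a := by
  have hz : 0 ≤ coin N k * (1 - a) := mul_nonneg (coin_nonneg N k) (sub_nonneg.2 ha.2)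
  refine sub_nonneg.2 (Real.le_sqrt_of_sq_le ?_)
  nlinarith [mul_nonneg hz ha.1]

/-- With `z = c_N(k)(1 - a)` this says `(z + u)² = z (a + z)`. The estimates on `u` use this
quadratic equation instead of the square root. -/
theorem u_sq (ha : a ∈ Set.Icc (0 : ℝ) 1) (k : ℕ) :
    u N k a ^ 2 = coin N k * (1 - a) * (a - 2 * u N k a) := by
  have hz : 0 ≤ coin N k * (1 - a) := mul_nonneg (coin_nonneg N k) (sub_nonneg.2 ha.2)
  have h := Real.sq_sqrt (mul_nonneg hz (add_nonneg ha.1 hz))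
  unfold u
  linear_combination h

theorem two_mul_u_le (ha : a ∈ Set.Icc (0 : ℝ) 1) (k : ℕ) : 2 * u N k a ≤ a := by
  by_contra! h
  have hz : 0 ≤ coin N k * (1 - a) := mul_nonneg (coin_nonneg N k) (sub_nonneg.2 ha.2)
  have h0 := u_nonneg (N := N) ha k
  have h1 := u_sq (N := N) ha k
  nlinarith [ha.1]

theorem u_le_u (ha : a ∈ Set.Icc (0 : ℝ) 1) {k l : ℕ} (hkl : coin N k ≤ coin N l) :
    u N k a ≤ u N l a := by
  by_contra! h
  have hz : coin N k * (1 - a) ≤ coin N l * (1 - a) :=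
    mul_le_mul_of_nonneg_right hkl (sub_nonneg.2 ha.2)
  have h0 := u_nonneg (N := N) ha l
  have hk := u_sq (N := N) ha k
  have hl := u_sq (N := N) ha l
  have h2 := two_mul_u_le (N := N) ha k
  have hz0 : 0 ≤ coin N l * (1 - a) := mul_nonneg (coin_nonneg N l) (sub_nonneg.2 ha.2)
  have h3 := mul_le_mul_of_nonneg_right hz (sub_nonneg.2 h2)
  have h4 := mul_le_mul_of_nonneg_left
    (show a - 2 * u N k a ≤ a - 2 * u N l a by linarith) hz0
  nlinarith

/-- If this failed for `a < b`, then `u(a) < u(b)` and `0 ≤ b - 2 u(b) ≤ a - 2 u(a)`, so `u_sq`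
would give `u(b)² ≤ u(a)²`. `β_{kk'}` is the sum of two such functions. -/
theorem strictAntiOn_half_add_u (N k : ℕ) :
    StrictAntiOn (fun a => (1 - a) / 2 + u N k a) (Set.Icc 0 1) := by
  intro a ha b hb hab
  by_contra! h
  have h0 := u_nonneg (N := N) ha k
  have hua := u_sq (N := N) ha k
  have hub := u_sq (N := N) hb k
  have h2 := two_mul_u_le (N := N) hb k
  have hc := coin_nonneg N k
  have h3 : coin N k * (1 - b) ≤ coin N k * (1 - a) := by gcongr
  have h4 := mul_le_mul_of_nonneg_right h3 (sub_nonneg.2 h2)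
  have h5 := mul_le_mul_of_nonneg_left
    (show b - 2 * u N k b ≤ a - 2 * u N k a by linarith)
    (mul_nonneg hc (sub_nonneg.2 ha.2))
  nlinarith

theorem strictAntiOn_beta (N k k' : ℕ) : StrictAntiOn (beta N k k') (Set.Icc 0 1) := by
  intro a ha b hb hab
  have h1 := strictAntiOn_half_add_u N k ha hb hab
  have h2 := strictAntiOn_half_add_u N k' ha hb hab
  simp only at h1 h2
  unfold beta
  linarith

theorem beta_zero (N k k' : ℕ) : beta N k k' 0 = 1 := by
  simp [beta, u, Real.sqrt_mul_self (coin_nonneg N _)]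

theorem beta_one (N k k' : ℕ) : beta N k k' 1 = 0 := by
  simp [beta, u]

theorem bijOn_beta (N k k' : ℕ) :
    Set.BijOn (beta N k k') (Set.Icc 0 1) (Set.Icc 0 1) := by
  have hc : Continuous (beta N k k') := by
    unfold beta u
    fun_prop
  refine ⟨fun a ha => ?_, (strictAntiOn_beta N k k').injOn, ?_⟩
  · have h0 := (strictAntiOn_beta N k k').antitoneOn (Set.left_mem_Icc.2 zero_le_one) ha ha.1
    have h1 := (strictAntiOn_beta N k k').antitoneOn ha (Set.right_mem_Icc.2 zero_le_one) ha.2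
    rw [beta_zero] at h0
    rw [beta_one] at h1
    exact ⟨h1, h0⟩
  · have h := intermediate_value_Icc' (zero_le_one (α := ℝ)) hc.continuousOn
    rwa [beta_zero, beta_one] at h

end Beta

/-! ### The mixed spectral observable: both bounds on the mixing parameter. -/

section Mixture

variable {N : ℕ} {a : ℝ}

theorem weight_le (n : QubitLabel N) : weight n ≤ N := by
  calc weight n ≤ ∑ _l : Fin N, 1 := Finset.sum_le_sum fun l _ => by omega
    _ = N := by simp

theorem card_weight_eq (N k : ℕ) :
    (Finset.univ.filter fun n : QubitLabel N => weight n = k).card = N.choose k := by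
  have hw : ∀ n : QubitLabel N, weight n = (Finset.univ.filter fun l => n l = 1).card := by
    intro n
    rw [weight, Finset.card_filter]
    refine Finset.sum_congr rfl fun l _ => ?_
    generalize n l = x
    fin_cases x <;> rfl
  conv_rhs => rw [← Finset.card_fin N, ← Finset.card_powersetCard]
  refine Finset.card_nbij' (fun n => Finset.univ.filter fun l => n l = 1)
    (fun s l => if l ∈ s then 1 else 0) ?_ ?_ ?_ ?_
  · intro n hn
    simpa [hw] using hn
  · intro s hs
    simpa [hw] using hs
  · intro n _
    funext l
    simp only [Finset.mem_filter, Finset.mem_univ, true_and]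
    generalize n l = x
    fin_cases x <;> rfl
  · intro s _
    ext l
    simp

theorem mixedObservable_eq (N : ℕ) (a : ℝ) (j : Fin (N + 1)) :
    mixedObservable N a j = Matrix.diagonal fun n =>
      ((a * (if weight n = (j : ℕ) then 1 else 0) + (1 - a) * coin N j : ℝ) : ℂ) := by
  have htr : (spectralObservable N j).trace = (N.choose j : ℂ) := by
    simp [spectralObservable, Matrix.trace_diagonal, Finset.sum_boole, card_weight_eq]
  ext n m
  by_cases h : n = m
  · subst h
    simp only [mixedObservable, depolarisedObservable, htr, coin,
      Matrix.add_apply, Matrix.smul_apply, Matrix.diagonal_apply_eq, Matrix.one_apply_eq,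
      smul_eq_mul]
    simp only [spectralObservable, Matrix.diagonal_apply_eq]
    split_ifs <;> push_cast <;> ring
  · simp [mixedObservable, depolarisedObservable, spectralObservable, h]

theorem sum_ite_eq_index {k : ℕ} (hk : k ≤ N) (x : ℝ) :
    ∑ j : Fin (N + 1), (if k = (j : ℕ) then x else 0) = x := by
  rw [Finset.sum_eq_single (⟨k, by omega⟩ : Fin (N + 1))]
  · simp
  · intro j _ hj
    rw [if_neg]
    rintro rfl
    exact hj rfl
  · simp

theorem isObservable_mixedObservable (ha : a ∈ Set.Icc (0 : ℝ) 1) :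
    IsObservable (mixedObservable N a) := by
  constructor
  · intro j
    rw [mixedObservable_eq]
    refine Matrix.PosSemidef.diagonal fun n => ?_
    have h1 := mul_nonneg (sub_nonneg.2 ha.2) (coin_nonneg N j)
    rw [Pi.zero_apply, Complex.zero_le_real]
    split_ifs <;> linarith [ha.1]
  · simp only [mixedObservable_eq]
    ext n m
    by_cases h : n = m
    · subst h
      simp only [Matrix.sum_apply, Matrix.diagonal_apply_eq, Matrix.one_apply_eq,
        ← Complex.ofReal_sum]
      rw [Finset.sum_add_distrib, ← Finset.mul_sum, ← Finset.mul_sum, sum_coin,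
        sum_ite_eq_index (weight_le n)]
      simp
    · simp [Matrix.sum_apply, h]

theorem continuous_mixedObservable (N : ℕ) : Continuous (mixedObservable N) := by
  unfold mixedObservable
  fun_prop

/-- Each `Q` imposes a closed condition on `a`, and an arbitrary intersection of closed sets is
closed. -/
theorem isClosed_compatibleMixing (N : ℕ) (t : ℝ) : IsClosed (compatibleMixing N t) := by
  have e : compatibleMixing N t = Set.Icc 0 1 ∩ ⋂ (Ω' : Type) (_ : Fintype Ω')
      (Q : Ω' → Matrix (QubitLabel N) (QubitLabel N) ℂ) (_ : IsObservable Q),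
      mixedObservable N ⁻¹' {F | JointlyMeasurable (fun i => coherenceMatrix N t ⊙ Q i) F} := by
    ext a
    simp only [compatibleMixing, compatibleSet, Set.mem_ofPred_eq, Set.mem_inter_iff,
      Set.mem_iInter, Set.mem_preimage]
    refine and_congr_right fun ha => ⟨fun h => h.2.2, fun h =>
      ⟨isObservable_mixedObservable ha, fun j => ?_, h⟩⟩
    rw [mixedObservable_eq]
    exact Matrix.isDiag_diagonal _
  rw [e]
  exact isClosed_Icc.inter <| isClosed_iInter fun _ => isClosed_iInter fun _ =>
    isClosed_iInter fun _ => isClosed_iInter fun _ =>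
      (isClosed_setOf_jointlyMeasurable _).preimage (continuous_mixedObservable N)

/-- A mixture is free of incompatibility as soon as the off-diagonal coherences, divided by
`β₀₀(a)`, extend to a positive definite sequence with value `1` at the origin. -/
theorem mem_compatibleMixing_of_isPosDefSeq {t : ℝ} (ha : a ∈ Set.Icc (0 : ℝ) 1) {h : ℤ → ℝ}
    (hpd : IsPosDefSeq h) (h0 : h 0 = 1)
    (hne : ∀ d ≠ 0, beta N 0 0 a * h d = t ^ (d.natAbs ^ 2)) : a ∈ compatibleMixing N t := by
  refine ⟨ha, ?_⟩
  have hz : ∀ k, 0 ≤ coin N k * (1 - a) := fun k =>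
    mul_nonneg (coin_nonneg N k) (sub_nonneg.2 ha.2)
  set e : Fin (N + 1) → QubitLabel N → ℝ := fun j n => if weight n = (j : ℕ) then 1 else 0 with he
  -- Write `z_j = c_N(j)(1 - a)`. With `u_j` in place of `u_0` this is an equality by `u_sq`, and
  -- `u_0 ≤ u_j` because `c_N(0)` is the least coin weight.
  have hblock : ∀ j : Fin (N + 1), (coin N j * (1 - a) + u N 0 a) ^ 2 ≤
      (a + coin N j * (1 - a)) * (coin N j * (1 - a)) := by
    intro j
    have h1 := u_le_u ha (coin_zero_le (N := N) (k := j) (by omega))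
    have h2 := u_nonneg (N := N) ha 0
    have h3 := u_sq (N := N) ha j
    have h4 : (coin N j * (1 - a) + u N 0 a) ^ 2 ≤ (coin N j * (1 - a) + u N j a) ^ 2 :=
      pow_le_pow_left₀ (add_nonneg (hz j) h2) (by linarith) 2
    linarith
  -- Block entries: `a + z_j` inside weight `j`, `z_j` outside, `z_j + u_0` across. Using the same
  -- `u_0` for all `j` makes the sum `1 - a + 2 u_0 = β₀₀(a)` for every pair of distinct weights.
  refine mem_compatibleSet_of_decomposition (isObservable_mixedObservable ha)
    (fun j => Matrix.of (fun n m => (((a + coin N j * (1 - a)) * (e j n * e j m) +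
      coin N j * (1 - a) * ((1 - e j n) * (1 - e j m)) + (coin N j * (1 - a) + u N 0 a) *
        (e j n * (1 - e j m) + (1 - e j n) * e j m) : ℝ) : ℂ)) ⊙
      Matrix.of fun n m => ((h ((weight n : ℤ) - weight m) : ℝ) : ℂ)) (fun j => ?_) ?_ (fun j => ?_)
  · exact (posSemidef_two_block (add_nonneg ha.1 (hz j)) (hz j) (hblock j) (e j)
      fun n => 1 - e j n).hadamard (hpd _ fun n => (weight n : ℤ))
  · ext n m
    simp only [Matrix.sum_apply, Matrix.hadamard_apply, Matrix.of_apply, coherenceMatrix,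
      ← Complex.ofReal_mul, ← Complex.ofReal_sum, ← Finset.sum_mul]
    congr 1
    by_cases hnm : weight n = weight m
    · have hs : ∀ j : Fin (N + 1), (a + coin N j * (1 - a)) * (e j n * e j m) +
          coin N j * (1 - a) * ((1 - e j n) * (1 - e j m)) + (coin N j * (1 - a) + u N 0 a) *
            (e j n * (1 - e j m) + (1 - e j n) * e j m) =
          (if weight m = (j : ℕ) then a else 0) + coin N j * (1 - a) := by
        intro j
        simp only [he, hnm]
        split_ifs <;> ring
      rw [Finset.sum_congr rfl fun j _ => hs j, Finset.sum_add_distrib,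
        sum_ite_eq_index (weight_le m), ← Finset.sum_mul, sum_coin, hnm, sub_self, h0]
      simp
    · have hs : ∀ j : Fin (N + 1), (a + coin N j * (1 - a)) * (e j n * e j m) +
          coin N j * (1 - a) * ((1 - e j n) * (1 - e j m)) + (coin N j * (1 - a) + u N 0 a) *
            (e j n * (1 - e j m) + (1 - e j n) * e j m) =
          (if weight n = (j : ℕ) then u N 0 a else 0) +
            (if weight m = (j : ℕ) then u N 0 a else 0) + coin N j * (1 - a) := by
        intro j
        simp only [he]
        split_ifs with h1 h2
        · exact absurd (h1.trans h2.symm) hnm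
        all_goals ring
      rw [Finset.sum_congr rfl fun j _ => hs j, Finset.sum_add_distrib, Finset.sum_add_distrib,
        sum_ite_eq_index (weight_le n), sum_ite_eq_index (weight_le m), ← Finset.sum_mul,
        sum_coin, ← hne _ (sub_ne_zero.2 (by exact_mod_cast hnm))]
      unfold beta
      ring
  · rw [mixedObservable_eq]
    ext n m
    by_cases hnm : n = m
    · subst hnm
      simp only [Matrix.hadamard_apply, Matrix.of_apply, Matrix.one_apply_eq, sub_self, h0,
        Matrix.diagonal_apply_eq, Complex.ofReal_one, mul_one, he]
      congr 1
      split_ifs <;> ring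
    · simp [hnm]

theorem mem_compatibleMixing_of_beta_eq {t : ℝ} (ht : t ∈ Set.Icc (0 : ℝ) 1)
    (ha : a ∈ Set.Icc (0 : ℝ) 1) (hb : beta N 0 0 a = 1 - theta3 (Real.pi / 2) t) :
    a ∈ compatibleMixing N t := by
  obtain ⟨hθ, hpd⟩ := theta3_spec ht
  rcases hθ.2.eq_or_lt with h1 | h1
  -- When `ϑ = 1` normalisation by `1 - ϑ` is impossible, but the sequence vanishes at `0`, hence
  -- everywhere, and no off-diagonal coherence between different weights remains.
  · refine mem_compatibleMixing_of_isPosDefSeq ha IsPosDefSeq.delta (by simp) fun d hd => ?_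
    have h := hpd.abs_le d
    have h' : t ^ (d.natAbs ^ 2) = 0 := by
      rw [← abs_nonpos_iff]
      simpa [hd, h1, -abs_pow] using h
    simp [hd, h']
  · have hpos : 0 < 1 - theta3 (Real.pi / 2) t := sub_pos.2 h1
    refine mem_compatibleMixing_of_isPosDefSeq ha (hpd.const_mul (inv_pos.2 hpos).le) ?_
      fun d hd => ?_
    · simp [hpos.ne']
    · rw [hb, mul_inv_cancel_left₀ hpos.ne']
      simp [hd]

theorem le_beta_of_mem_compatibleMixing {t : ℝ} (hN : 1 ≤ N) (ht : 0 ≤ t)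
    (h : a ∈ compatibleMixing N t) : t ≤ beta N 0 1 a := by
  obtain ⟨ha, hmem⟩ := h
  set n : QubitLabel N := 0 with hn
  set m : QubitLabel N := Pi.single ⟨0, hN⟩ 1 with hm
  have hwn : weight n = 0 := by simp [weight, hn]
  have hwm : weight m = 1 := by
    rw [weight, Finset.sum_eq_single (⟨0, hN⟩ : Fin N)]
    · simp [hm]
    · intro l _ hl
      simp [hm, hl]
    · simp
  have hnm : n ≠ m := by
    intro e
    rw [e, hwm] at hwn
    exact one_ne_zero hwn
  have key := norm_apply_le_of_mem_compatibleSet hmem hnm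
  have hC : ‖coherenceMatrix N t n m‖ = t := by
    simp [coherenceMatrix, hwn, hwm, abs_of_nonneg ht]
  rw [hC] at key
  have hz : ∀ k, 0 ≤ coin N k * (1 - a) := fun k =>
    mul_nonneg (coin_nonneg N k) (sub_nonneg.2 ha.2)
  -- The fidelity terms: `√(z_j (a + z_j)) = z_j + u_j` for `j = 0, 1`, and `z_j` otherwise; they
  -- sum to `β₀₁(a)`.
  have hs : ∀ j : Fin (N + 1),
      √((mixedObservable N a j n n).re * (mixedObservable N a j m m).re) =
      (if 0 = (j : ℕ) then u N 0 a else 0) + (if 1 = (j : ℕ) then u N 1 a else 0) +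
        coin N j * (1 - a) := by
    intro j
    simp only [mixedObservable_eq, Matrix.diagonal_apply_eq, Complex.ofReal_re, hwn, hwm]
    by_cases h0 : 0 = (j : ℕ)
    · simp only [← h0, if_true, one_ne_zero, if_false, u]
      rw [add_zero, sub_add_cancel]
      congr 1
      ring
    · by_cases h1 : 1 = (j : ℕ)
      · simp only [← h1, if_true, zero_ne_one, if_false, u]
        rw [zero_add, sub_add_cancel]
        congr 1
        ring
      · simp only [h0, h1, if_false]
        rw [mul_zero, zero_add, mul_comm (1 - a), Real.sqrt_mul_self (hz j)]
        ring
  rw [Finset.sum_congr rfl fun j _ => hs j, Finset.sum_add_distrib, Finset.sum_add_distrib,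
    sum_ite_eq_index (Nat.zero_le N), sum_ite_eq_index hN, ← Finset.sum_mul, sum_coin] at key
  unfold beta
  linarith

end Mixture

end SpinBoson

/-! ### Assembly of the bounds. -/

theorem proposition4 (N : ℕ) (hN : 1 ≤ N) :
    -- the inverse functions and the value of the theta function at `1` are well defined
    (StrictAntiOn (SpinBoson.beta N 0 1) (Set.Icc 0 1) ∧
      Set.BijOn (SpinBoson.beta N 0 1) (Set.Icc 0 1) (Set.Icc 0 1)) ∧
    (StrictAntiOn (SpinBoson.beta N 0 0) (Set.Icc 0 1) ∧
      Set.BijOn (SpinBoson.beta N 0 0) (Set.Icc 0 1) (Set.Icc 0 1)) ∧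
    Filter.Tendsto (SpinBoson.theta3Series (Real.pi / 2)) (nhdsWithin 1 (Set.Iio 1))
      (nhds (SpinBoson.theta3 (Real.pi / 2) 1)) ∧
    ∀ t : ℝ, t ∈ Set.Icc (0 : ℝ) 1 →
      SpinBoson.theta3 (Real.pi / 2) t ∈ Set.Icc (0 : ℝ) 1 ∧
      -- the critical parameter is an attained maximum
      IsGreatest (SpinBoson.compatibleMixing N t) (SpinBoson.critical N t) ∧
      -- the chain of bounds
      SpinBoson.theta3 (Real.pi / 2) t ≤ SpinBoson.lowerBound N t ∧
      SpinBoson.lowerBound N t ≤ SpinBoson.critical N t ∧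
      SpinBoson.critical N t ≤ SpinBoson.upperBound N t := by
  open SpinBoson in
  refine ⟨⟨strictAntiOn_beta N 0 1, bijOn_beta N 0 1⟩, ⟨strictAntiOn_beta N 0 0,
    bijOn_beta N 0 0⟩, theta3_one ▸ tendsto_theta3Series_one, fun t ht => ?_⟩
  obtain ⟨hθ, -⟩ := theta3_spec ht
  have hθ' : 1 - theta3 (Real.pi / 2) t ∈ Set.Icc (0 : ℝ) 1 :=
    ⟨sub_nonneg.2 hθ.2, sub_le_self _ hθ.1⟩
  have hLmem : lowerBound N t ∈ Set.Icc (0 : ℝ) 1 :=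
    Function.invFunOn_mem ((bijOn_beta N 0 0).surjOn hθ')
  have hLeq : beta N 0 0 (lowerBound N t) = 1 - theta3 (Real.pi / 2) t :=
    Function.invFunOn_eq ((bijOn_beta N 0 0).surjOn hθ')
  have hUmem : upperBound N t ∈ Set.Icc (0 : ℝ) 1 :=
    Function.invFunOn_mem ((bijOn_beta N 0 1).surjOn ht)
  have hUeq : beta N 0 1 (upperBound N t) = t :=
    Function.invFunOn_eq ((bijOn_beta N 0 1).surjOn ht)
  have hL := mem_compatibleMixing_of_beta_eq ht hLmem hLeq
  have hbdd : BddAbove (compatibleMixing N t) := ⟨1, fun a ha => ha.1.2⟩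
  have hmax : IsGreatest (compatibleMixing N t) (critical N t) :=
    ⟨(isClosed_compatibleMixing N t).csSup_mem ⟨_, hL⟩ hbdd, fun a ha => le_csSup hbdd ha⟩
  refine ⟨hθ, hmax, ?_, hmax.2 hL, ?_⟩
  -- `β₀₀(ϑ) = 1 - ϑ + 2 u_0(ϑ) ≥ 1 - ϑ = β₀₀(L)`, and `β₀₀` is decreasing.
  · rw [← (strictAntiOn_beta N 0 0).le_iff_ge hLmem hθ, hLeq, beta]
    linarith [u_nonneg (N := N) hθ 0]
  · rw [← (strictAntiOn_beta N 0 1).le_iff_ge hUmem hmax.1.1, hUeq]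
    exact le_beta_of_mem_compatibleMixing hN ht.1 hmax.1
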